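/- Let $(W,S)$ be a Coxeter system with identity $e$, length function $\ell$ and Bruhat order $\le$, whose covering relation is: $u\lhd v$ iff $u^{-1}v$ is a reflection and $\ell(v)=\ell(u)+1$. For $J\subseteq S$ let $W_J$ be the subgroup generated by $J$. Write $u=u^J\cdot u_J$ for the unique factorization of $u\in W$ in which $u_J\in W_J$ and $u^J$ has no right descent in $J$, and $u={}_Ju\cdot{}^J\!u$ for the unique factorization in which ${}_Ju\in W_J$ and ${}^J\!u$ has no left descent in $J$. For $w\in W$ let $w_0(J)$ be the maximum of $W_J\cap[e,w]$, and put $w_0(s,t)=w_0(\{s,t\})$. For $s\in S$ let $C_s=\{r\in S: rs=sr\}$, and for $s\in I\subseteq S$ let $K_s(I)=C_s\cup(S\setminus I)$. Let $\rho_s(x)=xs$ and $\lambda_s(x)=sx$. A matching of a poset $P$ is an involution $M:P\to P$ such that, for every $v\in P$, either $v\lhd M(v)$ or $M(v)\lhd v$. It is special if $u\lhd v$ and $M(u)\neq v$ imply $M(u)\le M(v)$. A special matching of $w\in W$ is a special matching of the interval $[e,w]$ in Bruhat order. With a quadruple $\mathcal R=(J,s,t,M_{st})$, where $J\subseteq S$,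 $s\in J$, $t\in S\setminus J$ and $M_{st}$ is a map on $[e,w_0(s,t)]$, associate $$M_{\mathcal R}(u)=(u^J)^{\{s,t\}}\cdot M_{st}\big((u^J)_{\{s,t\}}\cdot{}_{\{s\}}(u_J)\big)\cdot{}^{\{s\}}(u_J)\qquad(u\le w).$$ $\mathcal R$ is a right system for $w$ if: (R1) $M_{st}$ is a special matching of $w_0(s,t)$ with $M_{st}(e)=s$ and, if $t\le w_0(s,t)$, $M_{st}(t)=ts$; (R2) $M_{\mathcal R}(u)\le w$ for all $u\le w$; (R3) if $r\in J$ and $r\le w^J$, then $rs=sr$; (R4) if $\alpha\in\{s,t\}$ and $\alpha\le(w^J)^{\{s,t\}}$, then $M_{st}$ commutes with $\lambda_\alpha$, that is, $M_{st}(\alpha x)=\alpha M_{st}(x)$ whenever $x,\alpha x\in[e,w_0(s,t)]$; (R5) if $s\le{}^{\{s\}}(w_J)$, then $M_{st}$ commutes with $\rho_s$, that is, $M_{st}(xs)=M_{st}(x)s$ whenever $x,xs\in[e,w_0(s,t)]$. **Theorem.** Let $w\in W$ and $s\in I\subseteq S$ be such that $u^I s u_I\le w$ for all $u\le w$. Then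 the map $u\mapsto u^I s u_I$ is a special matching of $w$ if and only if $w^I\in W_{K_s(I)}$. Moreover, for every $t\in S\setminus I$, $\mathcal R=(I,s,t,\rho_s)$ is a right system for $w$ if and only if its associated map $M_{\mathcal R}$ is a special matching of $w$. -/

import Mathlib

/-- A matching of a poset `P`: an involution `M` of `P` such that `{v, M v}` is an edge of the
Hasse diagram of `P` for every `v`. -/
def IsPosetMatching {P : Type*} [PartialOrder P] (M : P → P) : Prop :=
  Function.Involutive M ∧ ∀ v : P, v ⋖ M v ∨ M v ⋖ v

/-- A matching `M` of `P` is special if `u ⋖ v` implies `M u ≤ M v` whenever `M u ≠ v`. -/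
def IsSpecialPosetMatching {P : Type*} [PartialOrder P] (M : P → P) : Prop :=
  IsPosetMatching M ∧ ∀ u v : P, u ⋖ v → M u ≠ v → M u ≤ M v

namespace CoxeterSystem

variable {B W : Type*} [Group W] {X : CoxeterMatrix B}

/-- The covering relation of Bruhat order: `u⁻¹ v` is a reflection and `ℓ(v) = ℓ(u) + 1`. -/
def BruhatCovers (cs : CoxeterSystem X W) (u v : W) : Prop :=
  cs.IsReflection (u⁻¹ * v) ∧ cs.length v = cs.length u + 1

/-- Bruhat order: the reflexive and transitive closure of its covering relation. -/
def BruhatLE (cs : CoxeterSystem X W) (u v : W) : Prop :=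
  Relation.ReflTransGen cs.BruhatCovers u v

theorem BruhatLE.length_le_and_eq {cs : CoxeterSystem X W} {u v : W} (h : cs.BruhatLE u v) :
    u = v ∨ cs.length u < cs.length v := by
  induction h with
  | refl => exact Or.inl rfl
  | tail _ hbc ih =>
    right
    have h1 := hbc.2
    rcases ih with rfl | h2 <;> omega

/-- The lower Bruhat interval `[e, w]`. -/
def LowerInterval (cs : CoxeterSystem X W) (w : W) : Type _ := {u : W // cs.BruhatLE u w}

/-- The lower Bruhat interval `[e, w]`, partially ordered by Bruhat order. -/
instance (cs : CoxeterSystem X W) (w : W) : PartialOrder (cs.LowerInterval w) where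
  le u v := cs.BruhatLE u.1 v.1
  le_refl _ := Relation.ReflTransGen.refl
  le_trans _ _ _ h1 h2 := Relation.ReflTransGen.trans h1 h2
  le_antisymm u v h1 h2 := by
    rcases h1.length_le_and_eq with h | h
    · exact Subtype.ext h
    · rcases h2.length_le_and_eq with h' | h'
      · exact Subtype.ext h'.symm
      · omega

/-- `M` is a special matching of `w`, that is, `M` maps the lower Bruhat interval `[e, w]` to itself
and its restriction to `[e, w]` is a special matching of this poset. The values of `M` outside
`[e, w]` are irrelevant. -/
def IsSpecialMatching (cs : CoxeterSystem X W) (w : W) (M : W → W) : Prop :=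
  ∃ h : ∀ u : W, cs.BruhatLE u w → cs.BruhatLE (M u) w,
    IsSpecialPosetMatching fun u : cs.LowerInterval w =>
      (⟨M u.1, h u.1 u.2⟩ : cs.LowerInterval w)

/-- The parabolic subgroup `W_J`. -/
def parabolic (cs : CoxeterSystem X W) (J : Set B) : Subgroup W :=
  Subgroup.closure (cs.simple '' J)

/-- The set `W^J` of the elements without right descents in `J`. -/
def minimalReps (cs : CoxeterSystem X W) (J : Set B) : Set W :=
  {w | ∀ j ∈ J, ¬ cs.IsRightDescent w j}

theorem exists_minimalRep (cs : CoxeterSystem X W) (J : Set B) (u : W) :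
    ∃ x, x ∈ cs.minimalReps J ∧ x⁻¹ * u ∈ cs.parabolic J := by
  classical
  have hex : ∃ n x, cs.length x = n ∧ x⁻¹ * u ∈ cs.parabolic J :=
    ⟨_, u, rfl, by simp [one_mem]⟩
  obtain ⟨x, hx, hxu⟩ := Nat.find_spec hex
  refine ⟨x, fun j hj hd => ?_, hxu⟩
  refine Nat.find_min hex (hx ▸ hd) ⟨x * cs.simple j, rfl, ?_⟩
  have hs : cs.simple j ∈ cs.parabolic J := Subgroup.subset_closure ⟨j, hj, rfl⟩
  simpa [mul_assoc] using mul_mem hs hxu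

/-- The factor `u^J` in `u = u^J u_J`, where `u^J ∈ W^J` and `u_J ∈ W_J`
(this factorization is unique). -/
noncomputable def upper (cs : CoxeterSystem X W) (J : Set B) (u : W) : W :=
  Classical.choose (cs.exists_minimalRep J u)

/-- The factor `u_J` in `u = u^J u_J`. -/
noncomputable def lower (cs : CoxeterSystem X W) (J : Set B) (u : W) : W :=
  (cs.upper J u)⁻¹ * u

/-- The factor `^J u` in the left factorization `u = _J u · ^J u`, where `_J u ∈ W_J` and
`^J u` has no left descents in `J`. -/
noncomputable def leftUpper (cs : CoxeterSystem X W) (J : Set B) (u : W) : W :=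
  (cs.upper J u⁻¹)⁻¹

/-- The factor `_J u` in the left factorization `u = _J u · ^J u`. -/
noncomputable def leftLower (cs : CoxeterSystem X W) (J : Set B) (u : W) : W :=
  (cs.lower J u⁻¹)⁻¹

theorem upper_mem (cs : CoxeterSystem X W) (J : Set B) (u : W) :
    cs.upper J u ∈ cs.minimalReps J :=
  (Classical.choose_spec (cs.exists_minimalRep J u)).1

theorem lower_mem (cs : CoxeterSystem X W) (J : Set B) (u : W) :
    cs.lower J u ∈ cs.parabolic J :=
  (Classical.choose_spec (cs.exists_minimalRep J u)).2

theorem upper_mul_lower (cs : CoxeterSystem X W) (J : Set B) (u : W) :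
    cs.upper J u * cs.lower J u = u := by
  simp [lower]

theorem leftLower_mul_leftUpper (cs : CoxeterSystem X W) (J : Set B) (u : W) :
    cs.leftLower J u * cs.leftUpper J u = u := by
  simp [leftLower, leftUpper, lower]

/-- `x` is the maximum of `W_J ∩ [e, w]` in Bruhat order. -/
def IsParabolicMax (cs : CoxeterSystem X W) (J : Set B) (w x : W) : Prop :=
  (x ∈ cs.parabolic J ∧ cs.BruhatLE x w) ∧
    ∀ y ∈ cs.parabolic J, cs.BruhatLE y w → cs.BruhatLE y x

open Classical in
/-- The element `w_0(J)`: the maximum of `W_J ∩ [e, w]` in Bruhat order (it is a known fact that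
it exists for all `J` and `w`, and it is then unique by antisymmetry). -/
noncomputable def parabolicMax (cs : CoxeterSystem X W) (J : Set B) (w : W) : W :=
  if h : ∃ x, cs.IsParabolicMax J w x then Classical.choose h else 1

/-- The set `C_s` of the generators that commute with `s` (including `s`). -/
def commutingGens (cs : CoxeterSystem X W) (s : B) : Set B :=
  {r | Commute (cs.simple r) (cs.simple s)}

/-- The set `K_s(I) = C_s ∪ (S ∖ I)`. -/
def KSet (cs : CoxeterSystem X W) (s : B) (I : Set B) : Set B :=
  cs.commutingGens s ∪ Iᶜ

/-- The map `u ↦ (u^J)^{s,t} · M_{st}((u^J)_{s,t} · _{s}(u_J)) · ^{s}(u_J)` associated with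
a quadruple `(J, s, t, M_{st})`. -/
noncomputable def systemMap (cs : CoxeterSystem X W) (J : Set B) (s t : B) (Mst : W → W)
    (u : W) : W :=
  cs.upper {s, t} (cs.upper J u) *
    Mst (cs.lower {s, t} (cs.upper J u) * cs.leftLower {s} (cs.lower J u)) *
      cs.leftUpper {s} (cs.lower J u)

/-- `(J, s, t, M_{st})` is a right system for `w`. Only the values of `Mst` on `[e, w_0(s,t)]`
matter; identities between values of `Mst` are required wherever both sides are defined. -/
structure IsRightSystem (cs : CoxeterSystem X W) (w : W) (J : Set B) (s t : B)
    (Mst : W → W) : Prop where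
  s_mem : s ∈ J
  t_notMem : t ∉ J
  special : cs.IsSpecialMatching (cs.parabolicMax {s, t} w) Mst
  map_one : Mst 1 = cs.simple s
  map_t : cs.BruhatLE (cs.simple t) (cs.parabolicMax {s, t} w) →
    Mst (cs.simple t) = cs.simple t * cs.simple s
  map_le : ∀ u, cs.BruhatLE u w → cs.BruhatLE (cs.systemMap J s t Mst u) w
  commute_of_le : ∀ r ∈ J, cs.BruhatLE (cs.simple r) (cs.upper J w) →
    Commute (cs.simple r) (cs.simple s)
  commute_left : ∀ α : B, α = s ∨ α = t →
    cs.BruhatLE (cs.simple α) (cs.upper {s, t} (cs.upper J w)) →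
    ∀ x, cs.BruhatLE x (cs.parabolicMax {s, t} w) →
      cs.BruhatLE (cs.simple α * x) (cs.parabolicMax {s, t} w) →
        Mst (cs.simple α * x) = cs.simple α * Mst x
  commute_right : cs.BruhatLE (cs.simple s) (cs.leftUpper {s} (cs.lower J w)) →
    ∀ x, cs.BruhatLE x (cs.parabolicMax {s, t} w) →
      cs.BruhatLE (x * cs.simple s) (cs.parabolicMax {s, t} w) →
        Mst (x * cs.simple s) = Mst x * cs.simple s

end CoxeterSystem

/-!
Write `M u = u^I s u_I` (`midMul`) and `K = K_s(I)`. Since `s ∈ I`, the map `M` is an involution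
of `W` and `{u, M u}` is always a cover, so the issue is when `M` is special on `[e, w]`. The condition
`w^I ∈ W_K` says that the generators of `I` below `w^I` commute with `s`
(`mem_parabolic_KSet_iff`).

*Sufficiency* (`midMul_le_midMul`). By the strong exchange property, a cover `u ◁ v` erases one
letter from the concatenation of reduced words of `v^I` and `v_I`. If the letter lies in `v_I`, the
claim reduces to the lifting property for left multiplication by `s`. If it lies in `v^I`, then
`u = y v_I` with `y ≤ v^I`, so `y_I ∈ W_{I ∩ K}` commutes with `s`, and `M u = y s v_I` is a
subword of `M v = v^I s v_I`.

*Necessity* (`mem_parabolic_KSet_of_isSpecialMatching`). If `y = r y' ∈ W^I` lies below `w` with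
`y' ∈ W_K` and `r ∈ I ∖ K`, then `M r = s r` and `M y = y s` cover `r` and `y`, and the lifting
property of special matchings gives `s r ≤ r y' s`. As `y' s ∈ W_K`, this forces `r s = s r`, against
`r ∉ K`. So `W^I ∩ [e, w] ⊆ W_K` by induction on the length.

The factor of `u_I` in `W_{s}` commutes with `s`, so the map associated with `(I, s, t, ρ_s)`
is `M` itself (`systemMap_mul_simple`). The field `commute_of_le` of right systems is the condition
`w^I ∈ W_K`, and the field `special` holds because `w_0(s,t)` descends at `s`
(`isRightDescent_parabolicMax`), so that `ρ_s` is a special matching of it by the lifting property.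

The Coxeter group theory used is derived from the presentation: the generators are pairwise
distinct by the geometric representation (`simple_injective`), the strong exchange property follows
from the action of `W` on `W × ℤ/2` (`IsReflection.exists_eraseIdx`), and the lifting and subword
properties of the Bruhat order are deduced from strong exchange applied to covers
(`BruhatCovers.mul_simple_le`).
-/

namespace CoxeterSystem

variable {B W : Type*} [Group W] {X : CoxeterMatrix B}

/-! ### The geometric representation and injectivity of the generators -/

/-- The linear form `v ↦ 2 B(e_i, v)` of the geometric representation on `B →₀ ℝ`, where
`B(e_i, e_j) = -cos (π / m_{ij})`. When `m_{ij}` is infinite (encoded by `0`) the value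
is `-2 cos 0 = -2`. -/
noncomputable def rootForm (X : CoxeterMatrix B) (i : B) : Module.Dual ℝ (B →₀ ℝ) :=
  Finsupp.linearCombination ℝ fun j => -2 * Real.cos (Real.pi / X i j)

theorem rootForm_single (X : CoxeterMatrix B) (i j : B) :
    rootForm X i (Finsupp.single j 1) = -2 * Real.cos (Real.pi / X i j) := by
  simp [rootForm]

theorem rootForm_single_self (X : CoxeterMatrix B) (i : B) :
    rootForm X i (Finsupp.single i 1) = 2 := by
  simp [rootForm_single]

open Polynomial.Chebyshev in
theorem reflection_pow_eq_one (X : CoxeterMatrix B) (i j : B) :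
    (Module.reflection (rootForm_single_self X i) *
      Module.reflection (rootForm_single_self X j)) ^ X i j = 1 := by
  rcases eq_or_ne i j with rfl | hij
  · rw [X.diagonal, pow_one]
    refine LinearEquiv.ext fun z => ?_
    rw [LinearEquiv.mul_apply, Module.involutive_reflection, LinearEquiv.coe_one, id]
  have hm1 : X i j ≠ 1 := X.off_diagonal i j hij
  have hf := rootForm_single X i j
  have hg := rootForm_single X j i
  rw [X.symmetric j i] at hg
  generalize X i j = m at *
  rcases Nat.eq_zero_or_pos m with rfl | hm0
  · simp
  refine LinearEquiv.ext fun z => ?_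
  rcases eq_or_ne m 2 with rfl | hm2
  · -- The Chebyshev coefficients do not vanish here; the two forms vanish instead.
    have h0 : Real.cos (Real.pi / (2 : ℕ)) = 0 := by simp
    rw [h0, mul_zero] at hf hg
    simp only [pow_two, LinearEquiv.mul_apply, Module.reflection_apply, map_sub, map_smul, hf, hg,
      rootForm_single_self]
    simp only [LinearEquiv.coe_one, id]
    module
  have hm3 : 3 ≤ m := by omega
  set θ : ℝ := 2 * Real.pi / m with hθ
  have hmpos : (0 : ℝ) < m := by positivity
  have ht : 2 * Real.cos θ = rootForm X i (Finsupp.single j 1) *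
      rootForm X j (Finsupp.single i 1) - 2 := by
    rw [hf, hg, hθ, mul_div_assoc, Real.cos_two_mul]
    ring
  have hsin : Real.sin θ ≠ 0 := by
    refine (Real.sin_pos_of_pos_of_lt_pi (by positivity) ?_).ne'
    rw [hθ, div_lt_iff₀ hmpos]
    have : (3 : ℝ) ≤ m := by exact_mod_cast hm3
    nlinarith [Real.pi_pos]
  have key := Module.reflection_mul_reflection_pow_apply (rootForm_single_self X i)
    (rootForm_single_self X j) m z (2 * Real.cos θ) ht
  rw [key]
  rcases Nat.even_or_odd' m with ⟨k, rfl | rfl⟩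
  · have h1 : (((2 * k : ℕ) : ℤ) - 2) / 2 = k - 1 := by omega
    have h2 : (((2 * k : ℕ) : ℤ) - 1) / 2 = k - 1 := by omega
    have h0 : (S ℝ ((k : ℤ) - 1)).eval (2 * Real.cos θ) = 0 := by
      have := S_two_mul_real_cos θ ((k : ℤ) - 1)
      rw [show ((((k : ℤ) - 1 : ℤ) : ℝ) + 1) * θ = Real.pi by
        have hk : (k : ℝ) ≠ 0 := Nat.cast_ne_zero.2 (by omega)
        rw [hθ]; push_cast; field_simp; ring, Real.sin_pi] at this
      exact (mul_eq_zero.1 this).resolve_right hsin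
    rw [h1, h2, h0]
    simp
  · have h1 : (((2 * k + 1 : ℕ) : ℤ) - 2) / 2 = k - 1 := by omega
    have h2 : (((2 * k + 1 : ℕ) : ℤ) - 1) / 2 = k := by omega
    have h3 : (((2 * k + 1 : ℕ) : ℤ) - 3) / 2 = k - 1 := by omega
    have h4 : ((2 * k + 1 : ℕ) : ℤ) / 2 = k := by omega
    have h0 : (S ℝ (k : ℤ)).eval (2 * Real.cos θ) +
        (S ℝ ((k : ℤ) - 1)).eval (2 * Real.cos θ) = 0 := by
      have e1 := S_two_mul_real_cos θ (k : ℤ)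
      have e2 := S_two_mul_real_cos θ ((k : ℤ) - 1)
      -- The angles `(k + 1) θ` and `k θ` add up to `2 π`, so their sines cancel.
      rw [show (((k : ℤ) : ℝ) + 1) * θ = 2 * Real.pi - ((((k : ℤ) - 1 : ℤ) : ℝ) + 1) * θ by
        rw [hθ]; push_cast; push_cast at hmpos; field_simp; ring, Real.sin_two_pi_sub] at e1
      refine (mul_eq_zero.1 (?_ : _ * Real.sin θ = 0)).resolve_right hsin
      rw [add_mul, e1, e2, neg_add_cancel]
    rw [h1, h2, h3, h4, h0]
    simp

theorem simple_injective (cs : CoxeterSystem X W) : Function.Injective cs.simple := by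
  intro i j hij
  let φ : W →* ((B →₀ ℝ) ≃ₗ[ℝ] (B →₀ ℝ)) := cs.lift
    ⟨fun i => Module.reflection (rootForm_single_self X i), reflection_pow_eq_one X⟩
  have hφ (k : B) : φ (cs.simple k) = Module.reflection (rootForm_single_self X k) :=
    cs.lift_apply_simple _ k
  have h := congrArg φ hij
  rw [hφ, hφ] at h
  have h2 := LinearEquiv.congr_fun h (Finsupp.single i 1)
  rw [Module.reflection_apply_self, Module.reflection_apply] at h2
  by_contra hne
  have h3 := DFunLike.congr_fun h2 i
  simp [Ne.symm hne] at h3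
  norm_num at h3

/-! ### The strong exchange property -/

open Classical in
/-- The involution `(t, ε) ↦ (s_i t s_i, ε + [t = s_i])` of `W × ℤ/2`. -/
noncomputable def reflPerm (cs : CoxeterSystem X W) (i : B) : Equiv.Perm (W × ZMod 2) :=
  Function.Involutive.toPerm
    (fun p => (cs.simple i * p.1 * cs.simple i, p.2 + if p.1 = cs.simple i then 1 else 0)) <| by
      rintro ⟨t, ε⟩
      have h : cs.simple i * t * cs.simple i = cs.simple i ↔ t = cs.simple i := by
        constructor
        · intro h
          have := congrArg (fun x => cs.simple i * x) h
          simp only [← mul_assoc, cs.simple_mul_simple_self, one_mul] at this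
          exact mul_eq_one_iff_eq_inv.1 this |>.trans (cs.inv_simple i)
        · rintro rfl
          simp
      ext1
      · simp [mul_assoc]
      · simp only [h, add_assoc]
        split_ifs <;> simp [CharTwo.add_self_eq_zero]

open Classical in
theorem reflPerm_apply (cs : CoxeterSystem X W) (i : B) (p : W × ZMod 2) :
    cs.reflPerm i p =
      (cs.simple i * p.1 * cs.simple i, p.2 + if p.1 = cs.simple i then 1 else 0) := rfl

open Classical in
/-- The `n`-th power of `s_i s_j` counts the `k < 2n` with `t = s_j (s_i s_j)^k`. -/
theorem reflPerm_mul_pow_apply (cs : CoxeterSystem X W) (i j : B) (n : ℕ) (t : W) (ε : ZMod 2) :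
    ((cs.reflPerm i * cs.reflPerm j) ^ n) (t, ε) =
      ((cs.simple i * cs.simple j) ^ n * t * ((cs.simple i * cs.simple j) ^ n)⁻¹,
        ε + ∑ k ∈ Finset.range (2 * n),
          if t = cs.simple j * (cs.simple i * cs.simple j) ^ k then 1 else 0) := by
  set a := cs.simple i * cs.simple j with ha
  have hja (k : ℕ) : cs.simple j * a ^ k * cs.simple j = (a ^ k)⁻¹ := by
    have h := conj_pow (i := k) (a := cs.simple j) (b := a)
    rw [cs.inv_simple] at h
    rw [← h, ← inv_pow, ha]
    simp [mul_assoc]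
  have hcomm (k : ℕ) : (a ^ k)⁻¹ * cs.simple j = cs.simple j * a ^ k := by
    rw [← hja]; simp [mul_assoc]
  induction n with
  | zero => simp
  | succ n ih =>
    have h1 : a ^ n * t * (a ^ n)⁻¹ = cs.simple j ↔ t = cs.simple j * a ^ (2 * n) := by
      rw [mul_inv_eq_iff_eq_mul, ← eq_inv_mul_iff_mul_eq, ← mul_assoc, hcomm, mul_assoc, ← pow_add,
        two_mul]
    have h2 : cs.simple j * (a ^ n * t * (a ^ n)⁻¹) * cs.simple j = cs.simple i ↔
        t = cs.simple j * a ^ (2 * n + 1) := by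
      have : cs.simple j * a = cs.simple j * cs.simple i * cs.simple j := by
        rw [ha, mul_assoc]
      rw [← eq_mul_inv_iff_mul_eq, ← eq_inv_mul_iff_mul_eq, cs.inv_simple, ← mul_assoc, ← this,
        mul_inv_eq_iff_eq_mul, ← eq_inv_mul_iff_mul_eq, ← mul_assoc, ← mul_assoc, hcomm]
      rw [show 2 * n + 1 = n + (1 + n) by omega, pow_add, pow_add, pow_one]
      simp only [mul_assoc]
    rw [pow_succ', Equiv.Perm.mul_apply, ih, Equiv.Perm.mul_apply, reflPerm_apply, reflPerm_apply]
    simp only [h1, h2]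
    ext1
    · simp [pow_succ', mul_assoc, ha]
    · rw [show 2 * (n + 1) = 2 * n + 1 + 1 by omega, Finset.sum_range_succ, Finset.sum_range_succ]
      simp only [add_assoc]

theorem reflPerm_isLiftable (cs : CoxeterSystem X W) : X.IsLiftable cs.reflPerm := by
  classical
  intro i j
  ext1 ⟨t, ε⟩
  rw [reflPerm_mul_pow_apply, cs.simple_mul_simple_pow, two_mul, Finset.sum_range_add]
  simp only [pow_add, cs.simple_mul_simple_pow, one_mul]
  simp [CharTwo.add_self_eq_zero]

/-- The action of `W` on `W × ℤ/2` extending `reflPerm`. -/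
noncomputable def reflAction (cs : CoxeterSystem X W) : W →* Equiv.Perm (W × ZMod 2) :=
  cs.lift ⟨cs.reflPerm, cs.reflPerm_isLiftable⟩

theorem reflAction_simple (cs : CoxeterSystem X W) (i : B) :
    cs.reflAction (cs.simple i) = cs.reflPerm i :=
  cs.lift_apply_simple _ i

open Classical in
/-- The parity of the multiplicity of `t` in the right inversion sequence of a word depends only
on the product of the word. -/
theorem reflAction_wordProd (cs : CoxeterSystem X W) (ω : List B) (t : W) (ε : ZMod 2) :
    cs.reflAction (cs.wordProd ω) (t, ε) =
      (cs.wordProd ω * t * (cs.wordProd ω)⁻¹, ε + ((cs.rightInvSeq ω).count t : ZMod 2)) := by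
  induction ω with
  | nil => simp
  | cons i ω ih =>
    have h : cs.wordProd ω * t * (cs.wordProd ω)⁻¹ = cs.simple i ↔
        (cs.wordProd ω)⁻¹ * cs.simple i * cs.wordProd ω = t := by
      rw [mul_inv_eq_iff_eq_mul, ← eq_inv_mul_iff_mul_eq, ← mul_assoc, eq_comm]
    rw [cs.wordProd_cons, map_mul, Equiv.Perm.mul_apply, ih, reflAction_simple, reflPerm_apply]
    simp only [h, rightInvSeq, List.count_cons, beq_iff_eq]
    ext1
    · simp [mul_assoc]
    · push_cast
      simp [add_assoc]

theorem reflAction_apply (cs : CoxeterSystem X W) (w t : W) (ε : ZMod 2) :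
    cs.reflAction w (t, ε) = (w * t * w⁻¹, ε + (cs.reflAction w (t, 0)).2) := by
  classical
  obtain ⟨ω, rfl⟩ := cs.wordProd_surjective w
  simp [reflAction_wordProd]

theorem IsReflection.reflAction_self {cs : CoxeterSystem X W} {t : W} (ht : cs.IsReflection t) :
    (cs.reflAction t (t, 0)).2 = 1 := by
  obtain ⟨u, i, rfl⟩ := ht
  have h1 : (cs.reflAction u⁻¹ (u * cs.simple i * u⁻¹, 0)).2 +
      (cs.reflAction u (cs.simple i, 0)).2 = 0 := by
    have h : cs.reflAction u (cs.reflAction u⁻¹ (u * cs.simple i * u⁻¹, 0)) =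
        (u * cs.simple i * u⁻¹, 0) := by
      rw [← Equiv.Perm.mul_apply, ← map_mul]; simp
    rw [reflAction_apply cs u⁻¹, reflAction_apply cs u] at h
    simpa [mul_assoc] using congrArg Prod.snd h
  rw [map_mul, map_mul, Equiv.Perm.mul_apply, Equiv.Perm.mul_apply, reflAction_apply cs u⁻¹,
    reflAction_simple, reflPerm_apply]
  simp only [inv_inv, mul_assoc, inv_mul_cancel, mul_one, inv_mul_cancel_left,
    cs.simple_mul_simple_self, if_true, zero_add]
  rw [reflAction_apply cs u]
  simp only [mul_assoc] at h1
  simp only [one_mul]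
  rw [add_right_comm, h1, zero_add]

theorem IsReflection.mem_rightInvSeq {cs : CoxeterSystem X W} {t : W} (ht : cs.IsReflection t)
    {ω : List B} (h : cs.length (cs.wordProd ω * t) < cs.length (cs.wordProd ω)) :
    t ∈ cs.rightInvSeq ω := by
  classical
  by_contra hmem
  have h0 : (cs.reflAction (cs.wordProd ω) (t, 0)).2 = 0 := by
    rw [reflAction_wordProd, List.count_eq_zero_of_not_mem hmem]; simp
  have h1 : (cs.reflAction (cs.wordProd ω * t) (t, 0)).2 = 1 := by
    rw [map_mul, Equiv.Perm.mul_apply, reflAction_apply cs t, reflAction_apply, ht.reflAction_self]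
    simp [h0]
  obtain ⟨τ, hτ, hτ'⟩ := cs.exists_isReduced (cs.wordProd ω * t)
  rw [hτ', reflAction_wordProd] at h1
  have hmem' : t ∈ cs.rightInvSeq τ := by
    by_contra hn
    rw [List.count_eq_zero_of_not_mem hn] at h1
    simp at h1
  have := (cs.isRightInversion_of_mem_rightInvSeq hτ hmem').2
  rw [← hτ', mul_assoc, ht.mul_self, mul_one] at this
  omega

/-- The strong exchange property; the word need not be reduced. -/
theorem IsReflection.exists_eraseIdx {cs : CoxeterSystem X W} {t : W} (ht : cs.IsReflection t)
    {ω : List B} (h : cs.length (cs.wordProd ω * t) < cs.length (cs.wordProd ω)) :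
    ∃ j < ω.length, cs.wordProd ω * t = cs.wordProd (ω.eraseIdx j) := by
  obtain ⟨j, hj, rfl⟩ := List.getElem_of_mem (ht.mem_rightInvSeq h)
  refine ⟨j, by simpa using hj, ?_⟩
  rw [← cs.wordProd_mul_getD_rightInvSeq, List.getD_eq_getElem]

/-! ### Lifting and subword properties of Bruhat order -/

theorem BruhatLE.refl (cs : CoxeterSystem X W) (u : W) : cs.BruhatLE u u :=
  Relation.ReflTransGen.refl

theorem BruhatLE.trans {cs : CoxeterSystem X W} {u v w : W} (h₁ : cs.BruhatLE u v)
    (h₂ : cs.BruhatLE v w) : cs.BruhatLE u w :=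
  Relation.ReflTransGen.trans h₁ h₂

theorem BruhatCovers.le {cs : CoxeterSystem X W} {u v : W} (h : cs.BruhatCovers u v) :
    cs.BruhatLE u v :=
  Relation.ReflTransGen.single h

theorem BruhatCovers.inv {cs : CoxeterSystem X W} {u v : W} (h : cs.BruhatCovers u v) :
    cs.BruhatCovers u⁻¹ v⁻¹ := by
  refine ⟨?_, by simpa using h.2⟩
  have := (h.1.conj v).isReflection_inv
  simpa [mul_assoc] using this

theorem BruhatLE.inv {cs : CoxeterSystem X W} {u v : W} (h : cs.BruhatLE u v) :
    cs.BruhatLE u⁻¹ v⁻¹ := by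
  induction h with
  | refl => exact BruhatLE.refl _ _
  | tail _ h ih => exact ih.trans h.inv.le

theorem bruhatLE_inv_iff {cs : CoxeterSystem X W} {u v : W} :
    cs.BruhatLE u⁻¹ v⁻¹ ↔ cs.BruhatLE u v :=
  ⟨fun h => by simpa using h.inv, BruhatLE.inv⟩

theorem BruhatCovers.of_mul_simple {cs : CoxeterSystem X W} {u : W} {i : B}
    (h : cs.length u < cs.length (u * cs.simple i)) : cs.BruhatCovers u (u * cs.simple i) := by
  refine ⟨by simpa using cs.isReflection_simple i, ?_⟩
  rcases cs.length_mul_simple u i with h' | h' <;> omega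

theorem BruhatCovers.mul_simple_of_lt {cs : CoxeterSystem X W} {u : W} {i : B}
    (h : cs.length (u * cs.simple i) < cs.length u) : cs.BruhatCovers (u * cs.simple i) u := by
  simpa using BruhatCovers.of_mul_simple (cs := cs) (u := u * cs.simple i) (i := i) (by simpa using h)

/-- A cover erases one letter from any word of its larger element. -/
theorem BruhatCovers.exists_eraseIdx {cs : CoxeterSystem X W} {u : W} {ω : List B}
    (h : cs.BruhatCovers u (cs.wordProd ω)) :
    ∃ j < ω.length, u = cs.wordProd (ω.eraseIdx j) := by
  have hr := h.1.isReflection_inv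
  have hu : cs.wordProd ω * (u⁻¹ * cs.wordProd ω)⁻¹ = u := by simp
  obtain ⟨j, hj, e⟩ := hr.exists_eraseIdx (ω := ω) (by rw [hu]; have := h.2; omega)
  exact ⟨j, hj, by rw [← e, hu]⟩

theorem exists_isReduced_concat {cs : CoxeterSystem X W} {v : W} {i : B}
    (h : cs.length (v * cs.simple i) < cs.length v) :
    ∃ ω, cs.IsReduced ω ∧ cs.IsReduced (ω ++ [i]) ∧ cs.wordProd (ω ++ [i]) = v := by
  obtain ⟨ω, hω, e⟩ := cs.exists_isReduced (v * cs.simple i)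
  have e' : cs.wordProd (ω ++ [i]) = v := by
    rw [cs.wordProd_append, ← e, cs.wordProd_singleton]; simp
  refine ⟨ω, hω, ?_, e'⟩
  have h1 := hω.eq
  rw [← e] at h1
  rw [IsReduced, e', List.length_append, List.length_singleton]
  rcases cs.length_mul_simple v i with h' | h' <;> omega

/-- Right multiplication by a generator is a special matching of the whole group. -/
theorem BruhatCovers.mul_simple_le {cs : CoxeterSystem X W} {u v : W} (i : B)
    (h : cs.BruhatCovers u v) (hne : u * cs.simple i ≠ v) :
    cs.BruhatLE (u * cs.simple i) (v * cs.simple i) := by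
  have hr : cs.IsReflection ((u * cs.simple i)⁻¹ * (v * cs.simple i)) := by
    have := h.1.conj (cs.simple i)
    simpa [mul_assoc] using this
  have hl := h.2
  rcases cs.length_mul_simple u i with hu | hu <;> rcases cs.length_mul_simple v i with hv | hv
  · exact BruhatCovers.le ⟨hr, by omega⟩
  · -- Exchange in a reduced word of `v` ending in `i` can only erase the last letter.
    obtain ⟨ω, hω, hω', rfl⟩ := exists_isReduced_concat (cs := cs) (v := v) (i := i) (by omega)
    obtain ⟨j, hj, rfl⟩ := h.exists_eraseIdx
    exfalso
    have hlen := hω'.eq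
    simp only [List.length_append, List.length_singleton] at hj hlen
    rcases Nat.lt_or_ge j ω.length with hj' | hj'
    · have e : cs.wordProd ((ω ++ [i]).eraseIdx j) = cs.wordProd (ω.eraseIdx j) * cs.simple i := by
        rw [List.eraseIdx_append_of_lt_length hj', cs.wordProd_append, cs.wordProd_singleton]
      rw [e] at hu hl
      rw [cs.simple_mul_simple_cancel_right] at hu
      have h1 := cs.length_wordProd_le (ω.eraseIdx j)
      rw [List.length_eraseIdx_of_lt hj'] at h1
      omega
    · obtain rfl : j = ω.length := by omega
      apply hne
      simp [List.eraseIdx_append_of_length_le, cs.wordProd_append]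
  · exact (BruhatCovers.mul_simple_of_lt (by omega)).le.trans
      (h.le.trans (BruhatCovers.of_mul_simple (by omega)).le)
  · exact BruhatCovers.le ⟨hr, by omega⟩

theorem BruhatCovers.simple_mul_le {cs : CoxeterSystem X W} {u v : W} (i : B)
    (h : cs.BruhatCovers u v) (hne : cs.simple i * u ≠ v) :
    cs.BruhatLE (cs.simple i * u) (cs.simple i * v) := by
  have := h.inv.mul_simple_le i fun e => hne (by rw [← inv_inj, ← e]; simp)
  rw [← bruhatLE_inv_iff]
  simpa using this

theorem BruhatLE.mul_simple_le_of_lt {cs : CoxeterSystem X W} {u v : W} {i : B}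
    (h : cs.BruhatLE u v) (hv : cs.length (v * cs.simple i) < cs.length v) :
    cs.BruhatLE (u * cs.simple i) v := by
  have key : cs.BruhatLE (u * cs.simple i) v ∨ cs.BruhatLE (u * cs.simple i) (v * cs.simple i) := by
    clear hv
    induction h with
    | refl => exact Or.inr (BruhatLE.refl _ _)
    | @tail b c hb hbc ih =>
      by_cases e : b * cs.simple i = c
      · rw [e] at ih
        rcases ih with ih | ih
        · exact Or.inl (ih.trans hbc.le)
        · exact Or.inl ih
      · rcases ih with ih | ih
        · exact Or.inl (ih.trans hbc.le)
        · exact Or.inr (ih.trans (hbc.mul_simple_le i e))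
  rcases key with k | k
  · exact k
  · exact k.trans (BruhatCovers.mul_simple_of_lt hv).le

theorem BruhatLE.le_or_mul_simple_le {cs : CoxeterSystem X W} {u v : W} (i : B)
    (h : cs.BruhatLE u v) :
    cs.BruhatLE u (v * cs.simple i) ∨ cs.BruhatLE (u * cs.simple i) (v * cs.simple i) := by
  induction h using Relation.ReflTransGen.head_induction_on with
  | refl => exact Or.inr (BruhatLE.refl _ _)
  | @head b c hbc _ ih =>
    by_cases e : b * cs.simple i = c
    · subst e
      rw [cs.simple_mul_simple_cancel_right] at ih
      rcases ih with ih | ih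
      · exact Or.inr ih
      · exact Or.inl ih
    · rcases ih with ih | ih
      · exact Or.inl (hbc.le.trans ih)
      · exact Or.inr ((hbc.mul_simple_le i e).trans ih)

/-- The lifting property: `u ≤ v` and `u < u s` imply `u ≤ v s`, also when `v s < v`. -/
theorem BruhatLE.le_mul_simple {cs : CoxeterSystem X W} {u v : W} {i : B}
    (h : cs.BruhatLE u v) (hu : cs.length u < cs.length (u * cs.simple i)) :
    cs.BruhatLE u (v * cs.simple i) := by
  rcases h.le_or_mul_simple_le i with k | k
  · exact k
  · exact (BruhatCovers.of_mul_simple hu).le.trans k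

theorem BruhatLE.mul_simple_le_mul_simple {cs : CoxeterSystem X W} {u v : W} {i : B}
    (h : cs.BruhatLE u v) (hv : cs.length v < cs.length (v * cs.simple i)) :
    cs.BruhatLE (u * cs.simple i) (v * cs.simple i) :=
  (h.trans (BruhatCovers.of_mul_simple hv).le).mul_simple_le_of_lt (by simpa using hv)

theorem exists_sublist_of_bruhatLE {cs : CoxeterSystem X W} {u : W} {ω : List B}
    (h : cs.BruhatLE u (cs.wordProd ω)) : ∃ σ, σ.Sublist ω ∧ u = cs.wordProd σ := by
  induction h using Relation.ReflTransGen.head_induction_on with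
  | refl => exact ⟨ω, List.Sublist.refl _, rfl⟩
  | head hbc _ ih =>
    obtain ⟨σ, hσ, rfl⟩ := ih
    obtain ⟨j, -, rfl⟩ := hbc.exists_eraseIdx
    exact ⟨_, (List.eraseIdx_sublist ..).trans hσ, rfl⟩

theorem IsReduced.of_append_left {cs : CoxeterSystem X W} {ω τ : List B}
    (h : cs.IsReduced (ω ++ τ)) : cs.IsReduced ω := by
  simpa using h.take ω.length

theorem IsReduced.bruhatLE_of_sublist {cs : CoxeterSystem X W} {ω : List B}
    (h : cs.IsReduced ω) : ∀ {σ : List B}, σ.Sublist ω →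
      cs.BruhatLE (cs.wordProd σ) (cs.wordProd ω) := by
  induction ω using List.reverseRecOn with
  | nil =>
    intro σ hσ
    rw [List.sublist_nil.1 hσ]
    exact BruhatLE.refl _ _
  | append_singleton ω i ih =>
    intro σ hσ
    have hω := h.of_append_left
    have hlt : cs.length (cs.wordProd ω) < cs.length (cs.wordProd ω * cs.simple i) := by
      have h1 := h.eq
      have h2 := hω.eq
      rw [cs.wordProd_append, cs.wordProd_singleton] at h1
      rw [h1, h2]; simp
    obtain ⟨σ₁, σ₂, rfl, h₁, h₂⟩ := List.sublist_append_iff.1 hσ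
    rw [cs.wordProd_append, cs.wordProd_append, cs.wordProd_singleton]
    rcases List.sublist_singleton.1 h₂ with rfl | rfl
    · simpa using (ih hω h₁).trans (BruhatCovers.of_mul_simple hlt).le
    · simpa using (ih hω h₁).mul_simple_le_mul_simple hlt

/-- The Bruhat order is compatible with products whose larger side is reduced. -/
theorem BruhatLE.mul {cs : CoxeterSystem X W} {a b x y : W} (hx : cs.BruhatLE a x)
    (hy : cs.BruhatLE b y) (h : cs.length (x * y) = cs.length x + cs.length y) :
    cs.BruhatLE (a * b) (x * y) := by
  obtain ⟨ω, hω, rfl⟩ := cs.exists_isReduced x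
  obtain ⟨τ, hτ, rfl⟩ := cs.exists_isReduced y
  obtain ⟨σ, hσ, rfl⟩ := exists_sublist_of_bruhatLE hx
  obtain ⟨ρ, hρ, rfl⟩ := exists_sublist_of_bruhatLE hy
  rw [← cs.wordProd_append, ← cs.wordProd_append]
  refine IsReduced.bruhatLE_of_sublist ?_ (hσ.append hρ)
  rw [IsReduced, cs.wordProd_append, h, hω.eq, hτ.eq, List.length_append]

theorem one_bruhatLE (cs : CoxeterSystem X W) (w : W) : cs.BruhatLE 1 w := by
  obtain ⟨ω, hω, rfl⟩ := cs.exists_isReduced w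
  simpa using hω.bruhatLE_of_sublist (List.nil_sublist ω)

/-- Elements below a product factor accordingly. -/
theorem BruhatLE.exists_mul {cs : CoxeterSystem X W} {u x y : W} (h : cs.BruhatLE u (x * y)) :
    ∃ a b, cs.BruhatLE a x ∧ cs.BruhatLE b y ∧ u = a * b := by
  obtain ⟨ω, hω, rfl⟩ := cs.exists_isReduced x
  obtain ⟨τ, hτ, rfl⟩ := cs.exists_isReduced y
  rw [← cs.wordProd_append] at h
  obtain ⟨σ, hσ, rfl⟩ := exists_sublist_of_bruhatLE h
  obtain ⟨σ₁, σ₂, rfl, h₁, h₂⟩ := List.sublist_append_iff.1 hσ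
  exact ⟨_, _, hω.bruhatLE_of_sublist h₁, hτ.bruhatLE_of_sublist h₂, cs.wordProd_append _ _⟩

/-! ### Parabolic subgroups and minimal coset representatives -/

theorem simple_mem_parabolic (cs : CoxeterSystem X W) {J : Set B} {i : B} (hi : i ∈ J) :
    cs.simple i ∈ cs.parabolic J :=
  Subgroup.subset_closure ⟨i, hi, rfl⟩

theorem wordProd_mem_parabolic (cs : CoxeterSystem X W) {J : Set B} {ω : List B}
    (h : ∀ i ∈ ω, i ∈ J) : cs.wordProd ω ∈ cs.parabolic J := by
  induction ω with
  | nil => simp [one_mem]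
  | cons i ω ih =>
    rw [cs.wordProd_cons]
    exact mul_mem (cs.simple_mem_parabolic (h i (by simp))) (ih fun j hj => h j (by simp [hj]))

/-- Every word contains a reduced word with the same product. -/
theorem exists_reduced_sublist (cs : CoxeterSystem X W) (ω : List B) :
    ∃ σ, σ.Sublist ω ∧ cs.IsReduced σ ∧ cs.wordProd σ = cs.wordProd ω := by
  induction ω using List.reverseRecOn with
  | nil => exact ⟨[], List.Sublist.refl _, by simp [IsReduced], rfl⟩
  | append_singleton ω i ih =>
    obtain ⟨σ, hσ, hr, e⟩ := ih
    rcases cs.length_mul_simple (cs.wordProd σ) i with h | h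
    · refine ⟨σ ++ [i], hσ.append (List.Sublist.refl _), ?_, ?_⟩
      · rw [IsReduced, cs.wordProd_append, cs.wordProd_singleton, h, hr.eq]; simp
      · rw [cs.wordProd_append, e, ← cs.wordProd_append]
    · obtain ⟨j, hj, e'⟩ := (cs.isReflection_simple i).exists_eraseIdx (ω := σ) (by omega)
      refine ⟨σ.eraseIdx j, ((List.eraseIdx_sublist ..).trans hσ).trans
        (List.sublist_append_left _ _), ?_, ?_⟩
      · rw [IsReduced, ← e', List.length_eraseIdx_of_lt hj]
        have := hr.eq
        omega
      · rw [← e', e, cs.wordProd_append, cs.wordProd_singleton]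

theorem exists_reduced_of_mem_parabolic {cs : CoxeterSystem X W} {J : Set B} {w : W}
    (hw : w ∈ cs.parabolic J) :
    ∃ ω, (∀ i ∈ ω, i ∈ J) ∧ cs.IsReduced ω ∧ w = cs.wordProd ω := by
  suffices h : ∃ ω, (∀ i ∈ ω, i ∈ J) ∧ w = cs.wordProd ω by
    obtain ⟨ω, hω, rfl⟩ := h
    obtain ⟨σ, hσ, hr, e⟩ := cs.exists_reduced_sublist ω
    exact ⟨σ, fun i hi => hω i (hσ.subset hi), hr, e.symm⟩
  induction hw using Subgroup.closure_induction with
  | mem x hx =>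
    obtain ⟨i, hi, rfl⟩ := hx
    exact ⟨[i], by simpa using hi, by simp⟩
  | one => exact ⟨[], by simp, by simp⟩
  | mul x y _ _ hx hy =>
    obtain ⟨ω, hω, rfl⟩ := hx
    obtain ⟨τ, hτ, rfl⟩ := hy
    refine ⟨ω ++ τ, ?_, (cs.wordProd_append _ _).symm⟩
    intro i hi
    rcases List.mem_append.1 hi with h | h
    exacts [hω i h, hτ i h]
  | inv x _ hx =>
    obtain ⟨ω, hω, rfl⟩ := hx
    exact ⟨ω.reverse, by simpa using hω, by simp⟩

theorem simple_mem_parabolic_iff (cs : CoxeterSystem X W) {J : Set B} {i : B} :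
    cs.simple i ∈ cs.parabolic J ↔ i ∈ J := by
  refine ⟨fun h => ?_, cs.simple_mem_parabolic⟩
  obtain ⟨ω, hω, hr, e⟩ := exists_reduced_of_mem_parabolic h
  have hl := hr.eq
  rw [← e, cs.length_simple] at hl
  obtain ⟨j, rfl⟩ := List.length_eq_one_iff.1 hl.symm
  rw [cs.wordProd_singleton] at e
  rw [cs.simple_injective e]
  exact hω j (by simp)

theorem BruhatLE.mem_parabolic {cs : CoxeterSystem X W} {J : Set B} {u w : W}
    (h : cs.BruhatLE u w) (hw : w ∈ cs.parabolic J) : u ∈ cs.parabolic J := by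
  obtain ⟨ω, hω, -, rfl⟩ := exists_reduced_of_mem_parabolic hw
  obtain ⟨σ, hσ, rfl⟩ := exists_sublist_of_bruhatLE h
  exact cs.wordProd_mem_parabolic fun i hi => hω i (hσ.subset hi)

theorem mem_parabolic_iff_simple_le {cs : CoxeterSystem X W} {J : Set B} {w : W} :
    w ∈ cs.parabolic J ↔ ∀ i, cs.BruhatLE (cs.simple i) w → i ∈ J := by
  refine ⟨fun h i hi => cs.simple_mem_parabolic_iff.1 (hi.mem_parabolic h), fun h => ?_⟩
  obtain ⟨ω, hr, rfl⟩ := cs.exists_isReduced w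
  refine cs.wordProd_mem_parabolic fun i hi => h i ?_
  simpa using hr.bruhatLE_of_sublist (List.singleton_sublist.2 hi)

theorem parabolic_inter {cs : CoxeterSystem X W} {J K : Set B} {w : W}
    (hJ : w ∈ cs.parabolic J) (hK : w ∈ cs.parabolic K) : w ∈ cs.parabolic (J ∩ K) := by
  rw [mem_parabolic_iff_simple_le] at *
  exact fun i hi => ⟨hJ i hi, hK i hi⟩

theorem mem_of_isRightDescent {cs : CoxeterSystem X W} {J : Set B} {w : W}
    (hw : w ∈ cs.parabolic J) {i : B} (h : cs.IsRightDescent w i) : i ∈ J := by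
  have h1 := (BruhatCovers.mul_simple_of_lt h).le.mem_parabolic hw
  rw [← cs.simple_mem_parabolic_iff]
  simpa using mul_mem (inv_mem hw) h1

/-- Lengths add up in `x W_J` once `x` has minimal length in this coset. -/
theorem length_mul_of_forall_le {cs : CoxeterSystem X W} {J : Set B} {x : W}
    (hx : ∀ z ∈ cs.parabolic J, cs.length x ≤ cs.length (x * z)) {y : W}
    (hy : y ∈ cs.parabolic J) : cs.length (x * y) = cs.length x + cs.length y := by
  obtain ⟨τ, hτ, hr, rfl⟩ := exists_reduced_of_mem_parabolic hy
  clear hy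
  induction τ using List.reverseRecOn with
  | nil => simp
  | append_singleton τ i ih =>
    have hτ' : ∀ j ∈ τ, j ∈ J := fun j hj => hτ j (by simp [hj])
    have hr' := hr.of_append_left
    have ih := ih hτ' hr'
    have hl := hr.eq
    have hl' := hr'.eq
    rw [hl, List.length_append, List.length_singleton, cs.wordProd_append, cs.wordProd_singleton,
      ← mul_assoc]
    rcases cs.length_mul_simple (x * cs.wordProd τ) i with h | h
    · omega
    exfalso
    obtain ⟨ω, hω, e⟩ := cs.exists_isReduced x
    obtain ⟨j, hj, e'⟩ := (cs.isReflection_simple i).exists_eraseIdx (ω := ω ++ τ) (by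
      rw [cs.wordProd_append, ← e]; omega)
    rw [cs.wordProd_append, ← e] at e'
    rcases Nat.lt_or_ge j ω.length with hj' | hj'
    · -- Erasing a letter of `x` yields a shorter element of the coset.
      rw [List.eraseIdx_append_of_lt_length hj', cs.wordProd_append] at e'
      have hmem := cs.wordProd_mem_parabolic hτ'
      have h1 := hx _ (mul_mem (mul_mem hmem (cs.simple_mem_parabolic (hτ i (by simp))))
        (inv_mem hmem))
      rw [show x * (cs.wordProd τ * cs.simple i * (cs.wordProd τ)⁻¹) =
        cs.wordProd (ω.eraseIdx j) by
          rw [← mul_assoc, ← mul_assoc, e', mul_inv_cancel_right]] at h1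
      have h2 := cs.length_wordProd_le (ω.eraseIdx j)
      have h3 := hω.eq
      rw [List.length_eraseIdx_of_lt hj'] at h2
      rw [← e] at h3
      omega
    · rw [List.eraseIdx_append_of_length_le hj', cs.wordProd_append, ← e, mul_assoc,
        mul_left_cancel_iff] at e'
      rw [List.length_append] at hj
      have h2 := cs.length_wordProd_le (τ.eraseIdx (j - ω.length))
      rw [List.length_eraseIdx_of_lt (by omega), ← e'] at h2
      rw [cs.wordProd_append, cs.wordProd_singleton, List.length_append,
        List.length_singleton] at hl
      omega

theorem exists_minimal_coset_rep (cs : CoxeterSystem X W) (J : Set B) (u : W) :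
    ∃ y ∈ cs.parabolic J,
      ∀ z ∈ cs.parabolic J, cs.length (u * y) ≤ cs.length (u * y * z) := by
  obtain ⟨y, hy, hmin⟩ := exists_minimalFor_of_wellFoundedLT
    (fun y => y ∈ cs.parabolic J) (fun y => cs.length (u * y)) ⟨1, one_mem _⟩
  refine ⟨y, hy, fun z hz => ?_⟩
  rw [mul_assoc]
  rcases le_total (cs.length (u * y)) (cs.length (u * (y * z))) with h | h
  · exact h
  · exact hmin (mul_mem hy hz) h

/-- An element without right descents in `J` has minimal length in its coset. -/
theorem length_le_of_mem_minimalReps {cs : CoxeterSystem X W} {J : Set B} {x : W}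
    (hx : x ∈ cs.minimalReps J) (z : W) (hz : z ∈ cs.parabolic J) :
    cs.length x ≤ cs.length (x * z) := by
  obtain ⟨y, hy, hmin⟩ := cs.exists_minimal_coset_rep J x
  obtain rfl | hne := eq_or_ne y 1
  · simpa using hmin z hz
  exfalso
  obtain ⟨i, hi⟩ := cs.exists_rightDescent_of_ne_one (inv_ne_one.2 hne)
  have hiJ := mem_of_isRightDescent (inv_mem hy) hi
  refine hx i hiJ ?_
  have h1 := length_mul_of_forall_le hmin (inv_mem hy)
  have h2 := length_mul_of_forall_le hmin (mul_mem (inv_mem hy) (cs.simple_mem_parabolic hiJ))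
  rw [mul_inv_cancel_right] at h1
  rw [← mul_assoc, mul_inv_cancel_right] at h2
  unfold IsRightDescent at hi ⊢
  omega

theorem length_mul_of_mem_minimalReps {cs : CoxeterSystem X W} {J : Set B} {x y : W}
    (hx : x ∈ cs.minimalReps J) (hy : y ∈ cs.parabolic J) :
    cs.length (x * y) = cs.length x + cs.length y :=
  length_mul_of_forall_le (length_le_of_mem_minimalReps hx) hy

theorem upper_mul {cs : CoxeterSystem X W} {J : Set B} {x y : W}
    (hx : x ∈ cs.minimalReps J) (hy : y ∈ cs.parabolic J) : cs.upper J (x * y) = x := by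
  have h := cs.upper_mul_lower J (x * y)
  have hl := cs.lower_mem J (x * y)
  have hu := cs.upper_mem J (x * y)
  have e : cs.upper J (x * y) = x * (y * (cs.lower J (x * y))⁻¹) := by
    rw [← mul_assoc, eq_mul_inv_iff_mul_eq, h]
  have hz : y * (cs.lower J (x * y))⁻¹ ∈ cs.parabolic J := mul_mem hy (inv_mem hl)
  have h1 := length_mul_of_mem_minimalReps hx hz
  have h2 := length_mul_of_mem_minimalReps hu (inv_mem hz)
  rw [← e] at h1
  nth_rw 1 [e] at h2
  rw [mul_inv_cancel_right] at h2
  have h3 : cs.length (y * (cs.lower J (x * y))⁻¹) = 0 := by omega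
  rw [cs.length_eq_zero_iff] at h3
  rw [e, h3, mul_one]

theorem lower_mul {cs : CoxeterSystem X W} {J : Set B} {x y : W}
    (hx : x ∈ cs.minimalReps J) (hy : y ∈ cs.parabolic J) : cs.lower J (x * y) = y := by
  rw [lower, upper_mul hx hy, inv_mul_cancel_left]

theorem length_upper_add_length_lower (cs : CoxeterSystem X W) (J : Set B) (u : W) :
    cs.length u = cs.length (cs.upper J u) + cs.length (cs.lower J u) := by
  conv_lhs => rw [← cs.upper_mul_lower J u]
  exact length_mul_of_mem_minimalReps (cs.upper_mem J u) (cs.lower_mem J u)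

theorem upper_le (cs : CoxeterSystem X W) (J : Set B) (u : W) : cs.BruhatLE (cs.upper J u) u := by
  have h := (BruhatLE.refl cs (cs.upper J u)).mul (cs.one_bruhatLE (cs.lower J u))
    (length_mul_of_mem_minimalReps (cs.upper_mem J u) (cs.lower_mem J u))
  rwa [mul_one, upper_mul_lower] at h

theorem lower_le (cs : CoxeterSystem X W) (J : Set B) (u : W) : cs.BruhatLE (cs.lower J u) u := by
  have h := (cs.one_bruhatLE (cs.upper J u)).mul (BruhatLE.refl cs (cs.lower J u))
    (length_mul_of_mem_minimalReps (cs.upper_mem J u) (cs.lower_mem J u))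
  rwa [one_mul, upper_mul_lower] at h

theorem upper_mem_parabolic_of_le {cs : CoxeterSystem X W} {J K : Set B} {u w : W}
    (h : cs.BruhatLE u w) (hw : cs.upper J w ∈ cs.parabolic K) :
    cs.upper J u ∈ cs.parabolic K := by
  rw [← cs.upper_mul_lower J w] at h
  obtain ⟨a, b, ha, hb, rfl⟩ := h.exists_mul
  have hbJ := hb.mem_parabolic (cs.lower_mem J w)
  rw [show a * b = cs.upper J a * (cs.lower J a * b) by rw [← mul_assoc, upper_mul_lower],
    upper_mul (cs.upper_mem J a) (mul_mem (cs.lower_mem J a) hbJ)]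
  exact ((cs.upper_le J a).trans ha).mem_parabolic hw

/-! ### The maximum of `W_J ∩ [e, w]` -/

theorem exists_isParabolicMax (cs : CoxeterSystem X W) (J : Set B) (w : W) :
    ∃ x, cs.IsParabolicMax J w x := by
  obtain ⟨ω, hω, rfl⟩ := cs.exists_isReduced w
  induction ω using List.reverseRecOn with
  | nil =>
    refine ⟨1, ⟨one_mem _, by simpa using BruhatLE.refl cs 1⟩, fun y _ hy => by simpa using hy⟩
  | append_singleton ω i ih =>
    obtain ⟨x, ⟨hxJ, hxw⟩, hmax⟩ := ih hω.of_append_left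
    have hlt : cs.length (cs.wordProd ω) < cs.length (cs.wordProd ω * cs.simple i) := by
      have h1 := hω.eq
      have h2 := hω.of_append_left.eq
      rw [cs.wordProd_append, cs.wordProd_singleton] at h1
      rw [h1, h2]; simp
    rw [cs.wordProd_append, cs.wordProd_singleton]
    have hcov := (BruhatCovers.of_mul_simple hlt).le
    -- Elements of `W_J` below `π ω * s_i` that do not descend at `i` are already below `π ω`.
    have hdown (y : W) (hy : cs.BruhatLE y (cs.wordProd ω * cs.simple i))
        (hi : cs.length y < cs.length (y * cs.simple i)) : cs.BruhatLE y (cs.wordProd ω) := by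
      simpa using hy.le_mul_simple hi
    by_cases hiJ : i ∈ J
    · have hsJ := cs.simple_mem_parabolic hiJ
      -- The maximum is the Demazure product of `x` and `s_i`.
      obtain ⟨z, hz, hzx, hzd⟩ : ∃ z, (z = x ∨ z = x * cs.simple i) ∧ cs.BruhatLE x z ∧
          cs.length (z * cs.simple i) < cs.length z := by
        rcases cs.length_mul_simple x i with h | h
        · exact ⟨x * cs.simple i, Or.inr rfl, (BruhatCovers.of_mul_simple (by omega)).le,
            by rw [cs.simple_mul_simple_cancel_right]; omega⟩
        · exact ⟨x, Or.inl rfl, BruhatLE.refl _ _, by omega⟩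
      refine ⟨z, ⟨?_, ?_⟩, fun y hyJ hy => ?_⟩
      · rcases hz with rfl | rfl
        exacts [hxJ, mul_mem hxJ hsJ]
      · rcases hz with rfl | rfl
        exacts [hxw.trans hcov, hxw.mul_simple_le_mul_simple hlt]
      · rcases cs.length_mul_simple y i with h | h
        · exact (hmax y hyJ (hdown y hy (by omega))).trans hzx
        · have h1 := hmax (y * cs.simple i) (mul_mem hyJ hsJ)
            (hdown _ ((BruhatCovers.mul_simple_of_lt (by omega)).le.trans hy)
              (by rw [cs.simple_mul_simple_cancel_right]; omega))
          simpa using (h1.trans hzx).mul_simple_le_of_lt hzd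
    · refine ⟨x, ⟨hxJ, hxw.trans hcov⟩, fun y hyJ hy => hmax y hyJ (hdown y hy ?_)⟩
      by_contra h
      have hne := cs.length_mul_simple_ne y i
      exact hiJ (mem_of_isRightDescent hyJ (show cs.length (y * cs.simple i) < _ by omega))

theorem parabolicMax_spec (cs : CoxeterSystem X W) (J : Set B) (w : W) :
    cs.IsParabolicMax J w (cs.parabolicMax J w) := by
  rw [parabolicMax, dif_pos (cs.exists_isParabolicMax J w)]
  exact Classical.choose_spec (cs.exists_isParabolicMax J w)

/-! ### Special matchings of lower Bruhat intervals -/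

theorem lowerInterval_covBy_iff {cs : CoxeterSystem X W} {w : W} {u v : cs.LowerInterval w} :
    u ⋖ v ↔ cs.BruhatCovers u.1 v.1 := by
  constructor
  · intro h
    rcases Relation.ReflTransGen.cases_head (show cs.BruhatLE u.1 v.1 from h.le) with e | ⟨c, hc, hcv⟩
    · exact absurd (Subtype.ext e) h.lt.ne
    · let c' : cs.LowerInterval w := ⟨c, BruhatLE.trans hcv v.2⟩
      have huc : u < c' := lt_of_le_of_ne hc.le fun e => by
        have h1 := hc.2
        have h2 : u.1 = c := congrArg Subtype.val e
        rw [h2] at h1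
        omega
      rcases eq_or_lt_of_le (show c' ≤ v from hcv) with e | hlt
      · rw [← e]; exact hc
      · exact absurd hlt (h.2 huc)
  · intro h
    have hlen (x y : cs.LowerInterval w) (hxy : x < y) : cs.length x.1 < cs.length y.1 :=
      (BruhatLE.length_le_and_eq hxy.le).resolve_left fun e => hxy.ne (Subtype.ext e)
    have h2 := h.2
    refine ⟨lt_of_le_of_ne h.le fun e => ?_, fun c h₁ h₂ => ?_⟩
    · rw [e] at h2
      omega
    · have := hlen _ _ h₁
      have := hlen _ _ h₂
      omega

/-- A special matching of `w` described by the covers in the whole group. -/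
theorem isSpecialMatching_iff {cs : CoxeterSystem X W} {w : W} {M : W → W} :
    cs.IsSpecialMatching w M ↔
      (∀ u, cs.BruhatLE u w → cs.BruhatLE (M u) w) ∧
      (∀ u, cs.BruhatLE u w → M (M u) = u) ∧
      (∀ u, cs.BruhatLE u w → cs.BruhatCovers u (M u) ∨ cs.BruhatCovers (M u) u) ∧
      ∀ u v, cs.BruhatLE v w → cs.BruhatCovers u v → M u ≠ v → cs.BruhatLE (M u) (M v) := by
  constructor
  · rintro ⟨h, ⟨hinv, hcov⟩, hsp⟩
    refine ⟨h, fun u hu => congrArg Subtype.val (hinv ⟨u, hu⟩), fun u hu => ?_,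
      fun u v hv huv hne => ?_⟩
    · exact (hcov ⟨u, hu⟩).imp lowerInterval_covBy_iff.1 lowerInterval_covBy_iff.1
    · exact hsp ⟨u, huv.le.trans hv⟩ ⟨v, hv⟩ (lowerInterval_covBy_iff.2 huv)
        fun e => hne (congrArg Subtype.val e)
  · rintro ⟨h, hinv, hcov, hsp⟩
    refine ⟨h, ⟨fun u => Subtype.ext (hinv u.1 u.2), fun u => ?_⟩, fun u v huv hne => ?_⟩
    · exact (hcov u.1 u.2).imp lowerInterval_covBy_iff.2 lowerInterval_covBy_iff.2
    · exact hsp u.1 v.1 v.2 (lowerInterval_covBy_iff.1 huv) fun e => hne (Subtype.ext e)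

/-- The lifting property of special matchings. -/
theorem IsSpecialMatching.map_le_map {cs : CoxeterSystem X W} {w : W} {M : W → W}
    (hM : cs.IsSpecialMatching w M) {u v : W} (huv : cs.BruhatLE u v) (hv : cs.BruhatLE v w)
    (hcov : cs.BruhatCovers v (M v)) : cs.BruhatLE (M u) (M v) := by
  obtain ⟨-, -, -, hsp⟩ := isSpecialMatching_iff.1 hM
  have key : cs.BruhatLE (M u) v ∨ cs.BruhatLE (M u) (M v) := by
    clear hcov
    induction huv with
    | refl => exact Or.inr (BruhatLE.refl _ _)
    | @tail b c _ hbc ih =>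
      specialize ih (hbc.le.trans hv)
      by_cases e : M b = c
      · rw [e] at ih
        exact Or.inl (ih.elim (fun k => k.trans hbc.le) id)
      · exact ih.imp (fun k => k.trans hbc.le) fun k => k.trans (hsp b c hv hbc e)
  exact key.elim (fun k => k.trans hcov.le) id

theorem isSpecialMatching_mul_simple {cs : CoxeterSystem X W} {w : W} {i : B}
    (h : cs.IsRightDescent w i) : cs.IsSpecialMatching w (fun x => x * cs.simple i) := by
  refine isSpecialMatching_iff.2 ⟨fun u hu => hu.mul_simple_le_of_lt h, fun u _ => by simp,
    fun u _ => ?_, fun u v _ huv hne => huv.mul_simple_le i hne⟩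
  rcases cs.length_mul_simple u i with h | h
  · exact Or.inl (BruhatCovers.of_mul_simple (by omega))
  · exact Or.inr (BruhatCovers.mul_simple_of_lt (by omega))

/-! ### The map `u ↦ u^I s u_I` -/

/-- The map `u ↦ u^I s u_I`. -/
noncomputable def midMul (cs : CoxeterSystem X W) (I : Set B) (s : B) (u : W) : W :=
  cs.upper I u * cs.simple s * cs.lower I u

theorem midMul_mul {cs : CoxeterSystem X W} {I : Set B} {x y : W} (s : B)
    (hx : x ∈ cs.minimalReps I) (hy : y ∈ cs.parabolic I) :
    cs.midMul I s (x * y) = x * (cs.simple s * y) := by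
  rw [midMul, upper_mul hx hy, lower_mul hx hy, mul_assoc]

theorem midMul_of_mem_minimalReps {cs : CoxeterSystem X W} {I : Set B} {x : W} (s : B)
    (hx : x ∈ cs.minimalReps I) : cs.midMul I s x = x * cs.simple s := by
  simpa using midMul_mul s hx (one_mem _)

theorem midMul_midMul {cs : CoxeterSystem X W} {I : Set B} {s : B} (hs : s ∈ I) (u : W) :
    cs.midMul I s (cs.midMul I s u) = u := by
  rw [midMul.eq_1 cs I s u, mul_assoc, midMul_mul s (cs.upper_mem I u)
    (mul_mem (cs.simple_mem_parabolic hs) (cs.lower_mem I u)),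
    cs.simple_mul_simple_cancel_left, upper_mul_lower]

theorem bruhatCovers_midMul {cs : CoxeterSystem X W} {I : Set B} {s : B} (hs : s ∈ I) (u : W) :
    cs.BruhatCovers u (cs.midMul I s u) ∨ cs.BruhatCovers (cs.midMul I s u) u := by
  have hr : cs.IsReflection (u⁻¹ * cs.midMul I s u) := by
    refine ⟨(cs.lower I u)⁻¹, s, ?_⟩
    rw [midMul]
    nth_rw 1 [← cs.upper_mul_lower I u]
    simp [mul_assoc]
  have hr' : cs.IsReflection ((cs.midMul I s u)⁻¹ * u) := by
    simpa using hr.isReflection_inv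
  have h1 := cs.length_upper_add_length_lower I u
  have h2 : cs.length (cs.midMul I s u) =
      cs.length (cs.upper I u) + cs.length (cs.simple s * cs.lower I u) := by
    rw [midMul, mul_assoc]
    exact length_mul_of_mem_minimalReps (cs.upper_mem I u)
      (mul_mem (cs.simple_mem_parabolic hs) (cs.lower_mem I u))
  rcases cs.length_simple_mul (cs.lower I u) s with h | h
  · exact Or.inl ⟨hr, by omega⟩
  · exact Or.inr ⟨hr', by omega⟩

theorem commute_of_mem_parabolic {cs : CoxeterSystem X W} {I : Set B} {s : B} {x : W}
    (hI : x ∈ cs.parabolic I) (hK : x ∈ cs.parabolic (cs.KSet s I)) :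
    Commute x (cs.simple s) := by
  have h := parabolic_inter hI hK
  clear hI hK
  induction h using Subgroup.closure_induction with
  | mem x hx =>
    obtain ⟨i, ⟨hi, hi'⟩, rfl⟩ := hx
    exact hi'.resolve_right fun h => h hi
  | one => exact Commute.one_left _
  | mul x y _ _ hx hy => exact hx.mul_left hy
  | inv x _ hx => exact hx.inv_left

/-- The generators of `I` below `w^I` commute with `s` exactly when `w^I ∈ W_{K_s(I)}`. -/
theorem mem_parabolic_KSet_iff {cs : CoxeterSystem X W} {I : Set B} {s : B} {x : W} :
    x ∈ cs.parabolic (cs.KSet s I) ↔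
      ∀ r ∈ I, cs.BruhatLE (cs.simple r) x → Commute (cs.simple r) (cs.simple s) := by
  rw [mem_parabolic_iff_simple_le]
  constructor
  · intro h r hr hle
    exact (h r hle).resolve_right fun h => h hr
  · intro h r hle
    by_cases hr : r ∈ I
    · exact Or.inl (h r hr hle)
    · exact Or.inr hr

theorem bruhatLE_mul_left {cs : CoxeterSystem X W} {I : Set B} {x y z : W}
    (hx : x ∈ cs.minimalReps I) (hz : z ∈ cs.parabolic I) (h : cs.BruhatLE y z) :
    cs.BruhatLE (x * y) (x * z) :=
  (BruhatLE.refl cs x).mul h (length_mul_of_mem_minimalReps hx hz)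

/-- A cover `u ◁ v` erases one letter of `v = v^I v_I`. If the letter lies in `v_I`, the claim is
the one for left multiplication by `s` in `W_I`. If it lies in `v^I`, then `u = y v_I` with
`y ≤ v^I`, the factor `y_I` commutes with `s`, and `y s v_I` is a subword of `v^I s v_I`. -/
theorem midMul_le_midMul {cs : CoxeterSystem X W} {I : Set B} {s : B} (hs : s ∈ I) {u v : W}
    (hv : cs.upper I v ∈ cs.parabolic (cs.KSet s I)) (huv : cs.BruhatCovers u v)
    (hne : cs.midMul I s u ≠ v) : cs.BruhatLE (cs.midMul I s u) (cs.midMul I s v) := by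
  have hsI := cs.simple_mem_parabolic hs
  have hx := cs.upper_mem I v
  have hy := cs.lower_mem I v
  have hv' := cs.upper_mul_lower I v
  generalize cs.upper I v = x at *
  generalize cs.lower I v = y at *
  subst hv'
  rw [midMul_mul s hx hy]
  obtain ⟨ω, hω, rfl⟩ := cs.exists_isReduced x
  obtain ⟨τ, hτI, hτ, rfl⟩ := exists_reduced_of_mem_parabolic hy
  have huv' := huv
  rw [← cs.wordProd_append] at huv'
  obtain ⟨j, hj, e⟩ := huv'.exists_eraseIdx
  rcases Nat.lt_or_ge j ω.length with hj' | hj'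
  · rw [List.eraseIdx_append_of_lt_length hj', cs.wordProd_append] at e
    have hle := hω.bruhatLE_of_sublist (List.eraseIdx_sublist ω j)
    generalize cs.wordProd (ω.eraseIdx j) = a at *
    have hc : Commute (cs.lower I a) (cs.simple s) :=
      commute_of_mem_parabolic (cs.lower_mem I a) (((cs.lower_le I a).trans hle).mem_parabolic hv)
    have hu : cs.midMul I s u = a * (cs.simple s * cs.wordProd τ) := by
      rw [e]
      nth_rw 1 [← cs.upper_mul_lower I a]
      rw [mul_assoc, midMul_mul s (cs.upper_mem I a) (mul_mem (cs.lower_mem I a) hy),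
        ← mul_assoc (cs.simple s), ← hc.eq, mul_assoc (cs.lower I a), ← mul_assoc, upper_mul_lower]
    rw [hu]
    exact hle.mul (BruhatLE.refl _ _) (length_mul_of_mem_minimalReps hx (mul_mem hsI hy))
  · rw [List.eraseIdx_append_of_length_le hj', cs.wordProd_append] at e
    have hb : cs.wordProd (τ.eraseIdx (j - ω.length)) ∈ cs.parabolic I :=
      cs.wordProd_mem_parabolic fun i hi => hτI i (List.mem_of_mem_eraseIdx hi)
    generalize cs.wordProd (τ.eraseIdx (j - ω.length)) = b at *
    subst e
    rw [midMul_mul s hx hb] at hne ⊢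
    have hcov : cs.BruhatCovers b (cs.wordProd τ) := by
      refine ⟨by simpa [mul_assoc] using huv.1, ?_⟩
      have := huv.2
      rw [length_mul_of_mem_minimalReps hx hy, length_mul_of_mem_minimalReps hx hb] at this
      omega
    exact bruhatLE_mul_left hx (mul_mem hsI hy)
      (hcov.simple_mul_le s fun e => hne (by rw [e]))

/-- If `s r ≤ r z` with `r ∉ K`, `z ∈ W_K` and `s ∈ K`, then `r` and `s` commute. Indeed `s r` or
`r s r` lies in `W_K`. The former is impossible. In the latter case `r` is not a right descent
of `r s r`, which therefore has length one and must be `s`. -/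
theorem commute_of_simple_mul_simple_le {cs : CoxeterSystem X W} {K : Set B} {r s : B} {z : W}
    (hr : r ∉ K) (hsK : s ∈ K) (hz : z ∈ cs.parabolic K)
    (h : cs.BruhatLE (cs.simple s * cs.simple r) (cs.simple r * z)) :
    Commute (cs.simple r) (cs.simple s) := by
  have hs' := cs.simple_mem_parabolic hsK
  obtain ⟨a, b, ha, hb, e⟩ := h.exists_mul
  have hbK := hb.mem_parabolic hz
  have ha' : a = 1 ∨ a = cs.simple r := by
    rw [← cs.wordProd_singleton] at ha
    obtain ⟨σ, hσ, rfl⟩ := exists_sublist_of_bruhatLE ha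
    rcases List.sublist_singleton.1 hσ with rfl | rfl <;> simp
  rcases ha' with rfl | rfl
  · rw [one_mul] at e
    rw [← e] at hbK
    exact absurd (cs.simple_mem_parabolic_iff.1 ((mul_mem_cancel_left hs').1 hbK)) hr
  · have hrs : r ≠ s := fun h => hr (h ▸ hsK)
    have e' : cs.simple r * (cs.simple s * cs.simple r) = b := by
      rw [e, cs.simple_mul_simple_cancel_left]
    have hnd : ¬ cs.IsRightDescent b r := fun h => hr (mem_of_isRightDescent hbK h)
    have h1 := cs.not_isRightDescent_iff.1 hnd
    rw [← e', ← mul_assoc, cs.simple_mul_simple_cancel_right] at h1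
    have h2 : cs.length (cs.simple r * cs.simple s) = 2 := by
      rcases cs.length_simple_mul (cs.simple s) r with h | h
      · rw [h, cs.length_simple]
      · rw [cs.length_simple] at h
        have h0 : cs.length (cs.simple r * cs.simple s) = 0 := by omega
        rw [cs.length_eq_zero_iff, mul_eq_one_iff_eq_inv, cs.inv_simple] at h0
        exact absurd (cs.simple_injective h0) hrs
    rw [h2] at h1
    obtain ⟨i, hi⟩ := cs.length_eq_one_iff.1 (show cs.length (cs.simple r * cs.simple s *
      cs.simple r) = 1 by omega)
    -- `r s r` is a generator `i ∈ K` of the subgroup generated by `r` and `s`, so `i = s`.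
    have hiK : i ∈ K := by
      rw [← cs.simple_mem_parabolic_iff, ← hi, mul_assoc, e']
      exact hbK
    have hrs' : i ∈ ({r, s} : Set B) := by
      rw [← cs.simple_mem_parabolic_iff, ← hi]
      exact mul_mem (mul_mem (cs.simple_mem_parabolic (by simp))
        (cs.simple_mem_parabolic (by simp))) (cs.simple_mem_parabolic (by simp))
    rcases hrs' with rfl | rfl
    · exact absurd hiK hr
    · have h3 := eq_mul_inv_of_mul_eq hi
      rwa [cs.inv_simple] at h3

/-- By induction on the length: write `y = r y'`. If `r` were not in `K_s(I)`, the lifting property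
of the special matching applied to `r ≤ y` would give `s r ≤ r y' s`. -/
theorem mem_parabolic_KSet_of_isSpecialMatching {cs : CoxeterSystem X W} {I : Set B} {s : B}
    (hs : s ∈ I) {w : W} (hM : cs.IsSpecialMatching w (cs.midMul I s)) {y : W}
    (hy : y ∈ cs.minimalReps I) (hyw : cs.BruhatLE y w) :
    y ∈ cs.parabolic (cs.KSet s I) := by
  induction hn : cs.length y generalizing y with
  | zero => rw [cs.length_eq_zero_iff.1 hn]; exact one_mem _
  | succ n ih =>
    obtain ⟨r, hr⟩ := cs.exists_leftDescent_of_ne_one (w := y) (by rintro rfl; simp at hn)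
    obtain ⟨z, rfl⟩ : ∃ z, y = cs.simple r * z := ⟨cs.simple r * y, by simp⟩
    rw [isLeftDescent_iff, cs.simple_mul_simple_cancel_left] at hr
    have hlen : cs.length (cs.simple r * z) = cs.length (cs.simple r) + cs.length z := by
      rw [cs.length_simple]; omega
    have hzy : cs.BruhatLE z (cs.simple r * z) := by
      simpa using (cs.one_bruhatLE (cs.simple r)).mul (BruhatLE.refl cs z) hlen
    have hry : cs.BruhatLE (cs.simple r) (cs.simple r * z) := by
      simpa using (BruhatLE.refl cs (cs.simple r)).mul (cs.one_bruhatLE z) hlen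
    have hz : z ∈ cs.minimalReps I := by
      intro i hi hd
      have h1 := cs.not_isRightDescent_iff.1 (hy i hi)
      have h2 := cs.length_mul_le (cs.simple r) (z * cs.simple i)
      rw [cs.length_simple, ← mul_assoc] at h2
      unfold IsRightDescent at hd
      omega
    have hzK := ih hz (hzy.trans hyw) (by omega)
    have hsK : s ∈ cs.KSet s I := Or.inl (Commute.refl _)
    by_cases hrK : r ∈ cs.KSet s I
    · exact mul_mem (cs.simple_mem_parabolic hrK) hzK
    have hrI : r ∈ I := by
      by_contra h
      exact hrK (Or.inr h)
    have hMy := midMul_of_mem_minimalReps s hy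
    have hMr : cs.midMul I s (cs.simple r) = cs.simple s * cs.simple r := by
      simpa using midMul_mul (cs := cs) (x := 1) s (fun i _ => cs.not_isRightDescent_one i)
        (cs.simple_mem_parabolic hrI)
    have h := hM.map_le_map hry hyw (by
      rw [hMy]
      exact BruhatCovers.of_mul_simple (by have := cs.not_isRightDescent_iff.1 (hy s hs); omega))
    rw [hMy, hMr, mul_assoc] at h
    exact absurd (Or.inl (commute_of_simple_mul_simple_le hrK hsK
      (mul_mem hzK (cs.simple_mem_parabolic hsK)) h)) hrK

theorem isSpecialMatching_midMul_iff {cs : CoxeterSystem X W} {I : Set B} {s : B} (hs : s ∈ I)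
    {w : W} (hw : ∀ u, cs.BruhatLE u w → cs.BruhatLE (cs.midMul I s u) w) :
    cs.IsSpecialMatching w (cs.midMul I s) ↔ cs.upper I w ∈ cs.parabolic (cs.KSet s I) := by
  refine ⟨fun hM => mem_parabolic_KSet_of_isSpecialMatching hs hM (cs.upper_mem I w)
    (cs.upper_le I w), fun h => isSpecialMatching_iff.2 ⟨hw, fun u _ => midMul_midMul hs u,
      fun u _ => bruhatCovers_midMul hs u, fun u v hv huv hne => ?_⟩⟩
  exact midMul_le_midMul hs (upper_mem_parabolic_of_le hv h) huv hne

/-! ### The right system `(I, s, t, ρ_s)` -/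

theorem eq_one_or_eq_simple_of_mem_parabolic {cs : CoxeterSystem X W} {s : B} {x : W}
    (hx : x ∈ cs.parabolic {s}) : x = 1 ∨ x = cs.simple s := by
  rw [parabolic, Set.image_singleton] at hx
  induction hx using Subgroup.closure_induction with
  | mem x hx => exact Or.inr hx
  | one => exact Or.inl rfl
  | mul x y _ _ hx hy => rcases hx with rfl | rfl <;> rcases hy with rfl | rfl <;> simp
  | inv x _ hx => rcases hx with rfl | rfl <;> simp

theorem commute_leftLower_singleton (cs : CoxeterSystem X W) (s : B) (u : W) :
    Commute (cs.leftLower {s} u) (cs.simple s) := by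
  rcases eq_one_or_eq_simple_of_mem_parabolic (inv_mem (cs.lower_mem {s} u⁻¹)) with h | h
  · rw [leftLower, h]; exact Commute.one_left _
  · rw [leftLower, h]

theorem systemMap_mul_simple (cs : CoxeterSystem X W) (I : Set B) (s t : B) :
    cs.systemMap I s t (fun x => x * cs.simple s) = cs.midMul I s := by
  funext u
  have h : cs.leftLower {s} (cs.lower I u) * (cs.simple s * cs.leftUpper {s} (cs.lower I u)) =
      cs.simple s * cs.lower I u := by
    rw [← mul_assoc, (cs.commute_leftLower_singleton s _).eq, mul_assoc, leftLower_mul_leftUpper]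
  simp only [systemMap, midMul, mul_assoc]
  rw [h, ← mul_assoc, upper_mul_lower]

/-- If `w_0(s,t)` did not descend at `s`, it would lie in `W^I`, and its image `w_0(s,t) s ≤ w`
would be a larger element of the parabolic subgroup. -/
theorem isRightDescent_parabolicMax {cs : CoxeterSystem X W} {I : Set B} {s t : B}
    (ht : t ∉ I) {w : W}
    (hw : ∀ u, cs.BruhatLE u w → cs.BruhatLE (cs.midMul I s u) w) :
    cs.IsRightDescent (cs.parabolicMax {s, t} w) s := by
  obtain ⟨⟨hJ, hle⟩, hmax⟩ := cs.parabolicMax_spec {s, t} w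
  by_contra hd
  have hmin : cs.parabolicMax {s, t} w ∈ cs.minimalReps I := by
    intro i hi hdi
    rcases mem_of_isRightDescent hJ hdi with rfl | rfl
    exacts [hd hdi, ht hi]
  have h1 := hw _ hle
  rw [midMul_of_mem_minimalReps s hmin] at h1
  have h2 := hmax _ (mul_mem hJ (cs.simple_mem_parabolic (by simp))) h1
  have h3 := cs.not_isRightDescent_iff.1 hd
  rcases h2.length_le_and_eq with h | h
  · rw [h] at h3; omega
  · omega

end CoxeterSystem

theorem mainTheorem4 {B W : Type*} [Group W] {X : CoxeterMatrix B} (cs : CoxeterSystem X W)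
    (w : W) (s : B) (I : Set B) (hs : s ∈ I)
    (hI : ∀ u : W, cs.BruhatLE u w →
      cs.BruhatLE (cs.upper I u * cs.simple s * cs.lower I u) w) :
    (cs.IsSpecialMatching w (fun u => cs.upper I u * cs.simple s * cs.lower I u) ↔
      cs.upper I w ∈ cs.parabolic (cs.KSet s I)) ∧
    ∀ t : B, t ∉ I →
      (cs.IsRightSystem w I s t (fun x => x * cs.simple s) ↔
        cs.IsSpecialMatching w (cs.systemMap I s t (fun x => x * cs.simple s))) := by
  have key := CoxeterSystem.isSpecialMatching_midMul_iff hs hI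
  refine ⟨key, fun t ht => ?_⟩
  rw [cs.systemMap_mul_simple I s t]
  constructor
  · intro h
    exact key.2 (CoxeterSystem.mem_parabolic_KSet_iff.2 h.commute_of_le)
  · intro hM
    exact
      { s_mem := hs
        t_notMem := ht
        special := CoxeterSystem.isSpecialMatching_mul_simple
          (CoxeterSystem.isRightDescent_parabolicMax ht hI)
        map_one := one_mul _
        map_t := fun _ => rfl
        map_le := by
          rw [cs.systemMap_mul_simple I s t]
          exact hI
        commute_of_le := CoxeterSystem.mem_parabolic_KSet_iff.1 (key.1 hM)
        commute_left := fun α _ _ x _ _ => mul_assoc _ _ _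
        commute_right := fun _ x _ _ => rfl }
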